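/- All graphs are simple and undirected. For a set $X$, the hypercube $\mathcal H(X)$ is the graph whose vertices are the finite subsets of $X$, two of them being adjacent if their symmetric difference is a singleton. A graph $G$ is a partial cube if, for some set $X$, there is a map from the vertices of $G$ to those of $\mathcal H(X)$ that preserves shortest path distances; the isometric dimension $\dim_I(G)$ of a partial cube $G$ is the least cardinality of such a set $X$. A subgraph $H$ of a graph $G$ is isometric if $d_H(a,b)=d_G(a,b)$ for all vertices $a,b$ of $H$. Let $G$ be a connected graph, and let $G_1=(V_1,E_1)$ and $G_2=(V_2,E_2)$ be isometric subgraphs of $G$ with $V_1\neq\emptyset\neq V_2$ and $G=G_1\cup G_2$ (union of both vertices and edges). The expansion of $G$ with respect to $G_1$ and $G_2$ is the graph whose vertex set is the disjoint union of $V_1$ and $V_2$ and whose edges are those of $G_1$, those of $G_2$, and, for every $x\in V_1\cap V_2$, one edge joining the two copies of $x$. Graphs are considered up to isomorphism, and a sequence of expansions may be empty. Corollary 8.2. (i) A finite connected graph is a partial cube if and only if it can be obtained from $K_1$ by a finite sequence of expansions. (ii) The number of expansions needed to produce a finite partial cube $G$ with at least one vertex from $K_1$ is $\dim_I(G)$: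 there is a sequence of exactly $\dim_I(G)$ expansions that produces $G$ from $K_1$, and every sequence of expansions that produces $G$ from $K_1$ has length $\dim_I(G)$. -/

import Mathlib

universe u v

namespace PartialCube

/-- The hypercube on a set `X`: its vertices are the finite subsets of `X`, and `P`, `Q` are joined
by an edge if their symmetric difference is a singleton. -/
def hypercube (X : Type u) : SimpleGraph (Finset X) where
  Adj P Q := ∃ x : X, symmDiff (P : Set X) (Q : Set X) = {x}
  symm := ⟨fun P Q h => by rwa [symmDiff_comm]⟩
  loopless := ⟨fun P h => by
    obtain ⟨x, hx⟩ := h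
    rw [symmDiff_self] at hx
    exact (Set.singleton_ne_empty x) hx.symm⟩

/-- `f` preserves the shortest path distance. The extended distance is `⊤` between different
components, so a graph with an isometric embedding into a connected graph is itself connected
(or empty); such an `f` is automatically injective, and it preserves and reflects adjacency. -/
def IsIsometricEmbedding {V : Type u} {W : Type v} (G : SimpleGraph V) (H : SimpleGraph W)
    (f : V → W) : Prop :=
  ∀ a b : V, H.edist (f a) (f b) = G.edist a b

/-- `G` is isometrically embeddable into the hypercube on `X`. -/
def EmbedsInHypercube {V : Type u} (G : SimpleGraph V) (X : Type v) : Prop :=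
  ∃ f : V → Finset X, IsIsometricEmbedding G (hypercube X) f

/-- A partial cube is a graph that can be isometrically embedded into a hypercube. Taking `X` in
the universe of the vertex type is no restriction: `X` may be replaced by the union of the finite
sets that occur in the image. -/
def IsPartialCube {V : Type u} (G : SimpleGraph V) : Prop :=
  ∃ X : Type u, EmbedsInHypercube G X

/-- The isometric dimension of a partial cube: the least cardinality of a set `X` such that the
graph is isometrically embeddable into the hypercube on `X`. -/
noncomputable def isometricDim {V : Type u} (G : SimpleGraph V) : Cardinal.{u} :=
  sInf {c : Cardinal.{u} | ∃ X : Type u, EmbedsInHypercube G X ∧ Cardinal.mk X = c}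

/-- A subgraph is isometric if distances inside it agree with distances in the whole graph. -/
def IsIsometricSubgraph {V : Type u} {G : SimpleGraph V} (H : G.Subgraph) : Prop :=
  IsIsometricEmbedding H.coe G (fun a => (a : V))

/-- The graph on the disjoint union of the vertex sets of `G₁` and `G₂` whose edges are those of
`G₁`, those of `G₂`, and the matching that joins the two copies of every common vertex. -/
def expansion {V : Type u} {G : SimpleGraph V} (G₁ G₂ : G.Subgraph) :
    SimpleGraph (G₁.verts ⊕ G₂.verts) where
  Adj
    | Sum.inl a, Sum.inl b => G₁.Adj a b
    | Sum.inr a, Sum.inr b => G₂.Adj a b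
    | Sum.inl a, Sum.inr b => (a : V) = b
    | Sum.inr a, Sum.inl b => (a : V) = b
  symm := ⟨by
    rintro (a | a) (b | b) h
    · exact G₁.adj_symm h
    · exact Eq.symm h
    · exact Eq.symm h
    · exact G₂.adj_symm h⟩
  loopless := ⟨by
    rintro (a | a) h
    · exact G₁.loopless.irrefl _ h
    · exact G₂.loopless.irrefl _ h⟩

/-- `G'` is (isomorphic to) an expansion of the connected graph `G`, with respect to two nonempty
isometric subgraphs of `G` whose union is `G`. -/
def IsExpansion {V : Type u} {W : Type v} (G : SimpleGraph V) (G' : SimpleGraph W) : Prop :=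
  G.Connected ∧ ∃ G₁ G₂ : G.Subgraph,
    G₁.verts.Nonempty ∧ G₂.verts.Nonempty ∧
    IsIsometricSubgraph G₁ ∧ IsIsometricSubgraph G₂ ∧
    G₁ ⊔ G₂ = ⊤ ∧ Nonempty (expansion G₁ G₂ ≃g G')

/-- `ObtainedByExpansions n G`: up to isomorphism, `G` is the last graph of a sequence of `n`
successive expansions that starts with `K₁`. -/
inductive ObtainedByExpansions : ℕ → ∀ {V : Type u}, SimpleGraph V → Prop
  | single {V : Type u} {G : SimpleGraph V} (h : Nonempty ((⊤ : SimpleGraph (Fin 1)) ≃g G)) :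
      ObtainedByExpansions 0 G
  | expand {n : ℕ} {V W : Type u} {G : SimpleGraph V} {G' : SimpleGraph W}
      (h : ObtainedByExpansions n G) (h' : IsExpansion G G') : ObtainedByExpansions (n + 1) G'

end PartialCube

/-!
Everything is expressed through isometric embeddings `f : V → Finset X` into a hypercube, where
isometric means that distances are Hamming distances. Let `cutCoords f` be the set of those
coordinates that separate two vertices.

The cardinality of `cutCoords f` does not depend on `f`. Indeed, every separating coordinate `x` is
the only difference between the ends of some edge `ab`, and the bipartition of the vertices induced
by `x` can be read off from distances alone: `w` is on the side of `a` if and only if it is closer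
to `a` than to `b`. Distinct separating coordinates induce distinct bipartitions, so they inject
into the coordinates of any other embedding (`mk_cutCoords_le`). Since coordinates that separate
nothing can be dropped, `cutCoords f` has cardinality `isometricDim G` (`isometricDim_eq`).

An expansion of a partial cube is embedded by adding one new coordinate that tells the two copies
apart (`isIsometricEmbedding_expansionMap`), and this increases the number of separating coordinates
by one. Conversely, erasing a separating coordinate `x` from all `f a` gives an isometrically
embedded graph, the contraction, with one separating coordinate less. The images of the two sides of
the cut `x` are isometric subgraphs that cover it, and the corresponding expansion is the original
graph (`isExpansion_contraction`). So a graph is obtained by `n` expansions if and only if it has an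
isometric embedding with exactly `n` separating coordinates, which gives both parts.
-/

namespace PartialCube

/-! ### Isometric embeddings into hypercubes -/

open SimpleGraph Finset

theorem hypercube_adj_iff {X : Type*} [DecidableEq X] {P Q : Finset X} :
    (hypercube X).Adj P Q ↔ (symmDiff P Q).card = 1 := by
  rw [Finset.card_eq_one]
  refine exists_congr fun x => ?_
  rw [← Finset.coe_symmDiff, ← Finset.coe_singleton, Finset.coe_inj]

theorem edist_map_le {V W : Type*} {G : SimpleGraph V} {H : SimpleGraph W} (φ : G →g H)
    (a b : V) : H.edist (φ a) (φ b) ≤ G.edist a b :=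
  le_iInf fun p => (edist_le (p.map φ)).trans_eq (by rw [Walk.length_map])

theorem edist_iso {V W : Type*} {G : SimpleGraph V} {H : SimpleGraph W} (φ : G ≃g H)
    (a b : V) : H.edist (φ a) (φ b) = G.edist a b :=
  le_antisymm (edist_map_le φ.toHom a b) (by simpa using edist_map_le φ.symm.toHom (φ a) (φ b))

theorem card_symmDiff_le {X : Type*} [DecidableEq X] (P Q R : Finset X) :
    (symmDiff P R).card ≤ (symmDiff P Q).card + (symmDiff Q R).card :=
  (card_le_card (symmDiff_triangle P Q R)).trans (card_union_le _ _)

/-- A map along which edges become edges of the hypercube does not increase distances. -/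
theorem card_symmDiff_le_edist {V X : Type*} [DecidableEq X] {G : SimpleGraph V}
    {f : V → Finset X} (hadj : ∀ a b, G.Adj a b → (symmDiff (f a) (f b)).card = 1) (a b : V) :
    ((symmDiff (f a) (f b)).card : ℕ∞) ≤ G.edist a b := by
  refine le_iInf fun p => ?_
  rw [Nat.cast_le]
  induction p with
  | nil => simp
  | cons h p ih =>
    have := card_symmDiff_le (f _) (f _) (f _) |>.trans (Nat.add_le_add (hadj _ _ h).le ih)
    rw [Walk.length_cons]
    omega

/-- Passing from `P` to a neighbour `R` in a direction in which `P` and `Q` differ decreases the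
Hamming distance to `Q` by one. -/
theorem card_symmDiff_of_step {X : Type*} [DecidableEq X] {P Q R : Finset X} {y : X}
    (hy : y ∈ symmDiff P Q) (h : symmDiff P R = {y}) :
    (symmDiff P Q).card = (symmDiff R Q).card + 1 := by
  have : symmDiff R Q = (symmDiff P Q).erase y := by
    rw [← symmDiff_symmDiff_cancel_left P R, h]
    ext z
    by_cases hz : z = y
    · subst hz
      simp only [mem_symmDiff, mem_singleton, mem_erase] at hy ⊢
      tauto
    · simp only [mem_symmDiff, mem_singleton, mem_erase]
      tauto
  rw [this, card_erase_add_one hy]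

/-- A local criterion for distances to be Hamming distances: edges become edges of the hypercube,
and from every vertex one can make a step that removes a difference to a given target. -/
theorem edist_eq_of_step {V X : Type*} [DecidableEq X] {G : SimpleGraph V} {f : V → Finset X}
    (hinj : Function.Injective f) (hadj : ∀ a b, G.Adj a b → (symmDiff (f a) (f b)).card = 1)
    (hstep : ∀ a b, f a ≠ f b →
      ∃ v, G.Adj a v ∧ ∃ y ∈ symmDiff (f a) (f b), symmDiff (f a) (f v) = {y}) (a b : V) :
    G.edist a b = (symmDiff (f a) (f b)).card := by
  refine le_antisymm ?_ (card_symmDiff_le_edist hadj a b)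
  induction hk : (symmDiff (f a) (f b)).card generalizing a with
  | zero =>
    have : a = b := hinj (by simpa using hk)
    simp [this]
  | succ k ih =>
    have hne : f a ≠ f b := by
      rintro h
      simp [h] at hk
    obtain ⟨v, hav, y, hy, hyv⟩ := hstep a b hne
    have := card_symmDiff_of_step hy hyv
    calc G.edist a b ≤ G.edist a v + G.edist v b := SimpleGraph.edist_triangle
      _ ≤ 1 + k := add_le_add (edist_eq_one_iff_adj.2 hav).le (ih v (by omega))
      _ = _ := by rw [add_comm]; rfl

theorem edist_hypercube {X : Type*} [DecidableEq X] (P Q : Finset X) :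
    (hypercube X).edist P Q = (symmDiff P Q).card := by
  refine edist_eq_of_step (f := id) Function.injective_id (fun _ _ => hypercube_adj_iff.1) ?_ P Q
  intro P Q h
  obtain ⟨y, hy⟩ := symmDiff_nonempty.2 h
  have : symmDiff P (symmDiff P {y}) = {y} := symmDiff_symmDiff_cancel_left _ _
  exact ⟨symmDiff P {y}, hypercube_adj_iff.2 (by rw [this, card_singleton]), y, hy, this⟩

/-- Distances in a hypercube are Hamming distances, so isometric embeddings can be described without
reference to the graph `hypercube X`. -/
theorem isIsometricEmbedding_hypercube_iff {V X : Type*} [DecidableEq X] {G : SimpleGraph V}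
    {f : V → Finset X} : IsIsometricEmbedding G (hypercube X) f ↔
      ∀ a b, G.edist a b = (symmDiff (f a) (f b)).card := by
  refine forall₂_congr fun a b => ?_
  rw [edist_hypercube, eq_comm]

section Isometric

variable {V X : Type*} [DecidableEq X] {G : SimpleGraph V} {f : V → Finset X}

theorem IsIsometricEmbedding.injective (hf : IsIsometricEmbedding G (hypercube X) f) :
    Function.Injective f := fun a b h => by
  rw [← edist_eq_zero_iff (G := G), isIsometricEmbedding_hypercube_iff.1 hf, h]
  simp

theorem IsIsometricEmbedding.adj_iff (hf : IsIsometricEmbedding G (hypercube X) f) {a b : V} :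
    G.Adj a b ↔ (symmDiff (f a) (f b)).card = 1 := by
  rw [← edist_eq_one_iff_adj, isIsometricEmbedding_hypercube_iff.1 hf]
  norm_cast

theorem IsIsometricEmbedding.preconnected (hf : IsIsometricEmbedding G (hypercube X) f) :
    G.Preconnected := fun a b => by
  rw [← edist_ne_top_iff_reachable, isIsometricEmbedding_hypercube_iff.1 hf]
  exact ENat.natCast_ne_top _

/-- The first edge of a geodesic from `a` to `b` removes one of their differences. -/
theorem IsIsometricEmbedding.exists_step (hf : IsIsometricEmbedding G (hypercube X) f) {a b : V}
    (h : f a ≠ f b) :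
    ∃ v, G.Adj a v ∧ ∃ y ∈ symmDiff (f a) (f b), symmDiff (f a) (f v) = {y} := by
  have hd := isIsometricEmbedding_hypercube_iff.1 hf
  obtain ⟨p, hp⟩ := exists_walk_of_edist_eq_coe (hd a b)
  cases p with
  | nil => exact absurd rfl h
  | @cons _ v _ hav p =>
    refine ⟨v, hav, ?_⟩
    obtain ⟨y, hy⟩ := card_eq_one.1 (hf.adj_iff.1 hav)
    refine ⟨y, ?_, hy⟩
    have hle : (symmDiff (f v) (f b)).card ≤ p.length := by
      have := edist_le p
      rw [hd v b] at this
      exact_mod_cast this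
    by_contra hyb
    have hy' : y ∈ symmDiff (f v) (f b) := by
      have : y ∈ symmDiff (f a) (f v) := by simp [hy]
      simp only [mem_symmDiff] at this hyb ⊢
      tauto
    have := card_symmDiff_of_step hy' (by rw [symmDiff_comm, hy])
    rw [Walk.length_cons] at hp
    omega

end Isometric

/-! ### Separating coordinates and the isometric dimension -/

/-- The coordinates that separate two vertices, that is, those that are not constant along `f`. -/
def cutCoords {V X : Type*} (f : V → Finset X) : Set X := {x | ∃ a b, x ∈ f a ∧ x ∉ f b}

theorem exists_adj_of_mem_cutCoords {V X : Type*} [DecidableEq X] {G : SimpleGraph V}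
    {f : V → Finset X} (hf : IsIsometricEmbedding G (hypercube X) f) {x : X}
    (hx : x ∈ cutCoords f) : ∃ a b, G.Adj a b ∧ symmDiff (f a) (f b) = {x} := by
  obtain ⟨a, b, ha, hb⟩ := hx
  obtain ⟨p⟩ := hf.preconnected a b
  obtain ⟨d, -, hd, hd'⟩ := p.exists_boundary_dart {v | x ∈ f v} ha hb
  refine ⟨d.fst, d.snd, d.adj, ?_⟩
  obtain ⟨y, hy⟩ := card_eq_one.1 (hf.adj_iff.1 d.adj)
  have : x ∈ symmDiff (f d.fst) (f d.snd) := mem_symmDiff.2 (Or.inl ⟨hd, hd'⟩)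
  rw [hy, mem_singleton] at this
  rw [hy, this]

/-- An edge `ab` with label `x` determines the bipartition of the vertices given by the
coordinate `x`: the side of `a` consists of the vertices that are closer to `a` than to `b`. -/
theorem edist_lt_edist_iff {V X : Type*} [DecidableEq X] {G : SimpleGraph V}
    {f : V → Finset X} (hf : IsIsometricEmbedding G (hypercube X) f) {a b : V} {x : X}
    (h : symmDiff (f a) (f b) = {x}) (w : V) :
    G.edist a w < G.edist b w ↔ x ∉ symmDiff (f a) (f w) := by
  have hd := isIsometricEmbedding_hypercube_iff.1 hf
  rw [hd, hd, Nat.cast_lt]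
  by_cases hx : x ∈ symmDiff (f a) (f w)
  · have := card_symmDiff_of_step hx h
    simp only [hx, not_true_eq_false, iff_false]
    omega
  · have hx' : x ∈ symmDiff (f b) (f w) := by
      have : x ∈ symmDiff (f a) (f b) := by simp [h]
      simp only [mem_symmDiff] at this hx ⊢
      tauto
    have := card_symmDiff_of_step hx' (by rw [symmDiff_comm, h])
    simp only [hx, not_false_eq_true, iff_true]
    omega

theorem mem_symmDiff_iff_edist_lt {V X : Type*} [DecidableEq X] {G : SimpleGraph V}
    {f : V → Finset X} (hf : IsIsometricEmbedding G (hypercube X) f) {a b : V} {x : X}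
    (h : symmDiff (f a) (f b) = {x}) (v w : V) :
    x ∈ symmDiff (f v) (f w) ↔
      ¬(G.edist a v < G.edist b v ↔ G.edist a w < G.edist b w) := by
  rw [edist_lt_edist_iff hf h, edist_lt_edist_iff hf h]
  simp only [mem_symmDiff]
  tauto

/-- Mapping a coordinate of `f` to the label under `g` of an edge that crosses it is injective,
as both labels determine the same bipartition. -/
theorem mk_cutCoords_le {V X Y : Type u} {G : SimpleGraph V}
    {f : V → Finset X} (hf : IsIsometricEmbedding G (hypercube X) f)
    {g : V → Finset Y} (hg : IsIsometricEmbedding G (hypercube Y) g) :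
    Cardinal.mk (cutCoords f) ≤ Cardinal.mk Y := by
  classical
  have key : ∀ x : cutCoords f, ∃ y : Y, ∃ a b, symmDiff (f a) (f b) = {x.1} ∧
      symmDiff (g a) (g b) = {y} := fun x => by
    obtain ⟨a, b, hab, h⟩ := exists_adj_of_mem_cutCoords hf x.2
    obtain ⟨y, hy⟩ := card_eq_one.1 (hg.adj_iff.1 hab)
    exact ⟨y, a, b, h, hy⟩
  choose F hF using key
  refine Cardinal.mk_le_of_injective (f := F) fun x x' hxx' => ?_
  obtain ⟨a, b, hfx, hgx⟩ := hF x
  obtain ⟨c, d, hfx', hgx'⟩ := hF x'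
  rw [← hxx'] at hgx'
  have h4 : x'.1 ∈ symmDiff (f a) (f b) := by
    rw [mem_symmDiff_iff_edist_lt hf hfx', ← mem_symmDiff_iff_edist_lt hg hgx', hgx]
    exact mem_singleton_self _
  rw [hfx, mem_singleton] at h4
  exact Subtype.ext h4.symm

/-- The number of separating coordinates is the same for all isometric embeddings of a graph. -/
theorem isometricDim_eq {V X : Type u} {G : SimpleGraph V}
    {f : V → Finset X} (hf : IsIsometricEmbedding G (hypercube X) f) :
    isometricDim G = Cardinal.mk (cutCoords f) := by
  classical
  -- Dropping the coordinates that are constant along `f` does not change Hamming distances.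
  have hmem : Cardinal.mk (cutCoords f) ∈
      {c : Cardinal.{u} | ∃ X : Type u, EmbedsInHypercube G X ∧ Cardinal.mk X = c} := by
    refine ⟨cutCoords f, ⟨fun a => (f a).subtype (· ∈ cutCoords f), ?_⟩, rfl⟩
    rw [isIsometricEmbedding_hypercube_iff]
    intro a b
    rw [isIsometricEmbedding_hypercube_iff.1 hf,
      ← card_map (s := symmDiff (Finset.subtype _ (f a)) _) (Function.Embedding.subtype _)]
    congr 2
    ext x
    simp only [mem_map, mem_symmDiff, mem_subtype, Function.Embedding.subtype_apply]
    constructor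
    · rintro (⟨h, h'⟩ | ⟨h, h'⟩)
      exacts [⟨⟨x, a, b, h, h'⟩, Or.inl ⟨h, h'⟩, rfl⟩, ⟨⟨x, b, a, h, h'⟩, Or.inr ⟨h, h'⟩, rfl⟩]
    · rintro ⟨x, h, rfl⟩
      exact h
  refine le_antisymm (csInf_le' hmem) (le_csInf ⟨_, hmem⟩ ?_)
  rintro _ ⟨Y, ⟨g, hg⟩, rfl⟩
  exact mk_cutCoords_le hf hg

/-! ### Expansions of partial cubes -/

section Expansion

variable {V : Type*} {G : SimpleGraph V} {G₁ G₂ : G.Subgraph}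

/-- The inclusion of the first copy into an expansion. -/
def expansionInl (G₁ G₂ : G.Subgraph) : G₁.coe →g expansion G₁ G₂ := ⟨Sum.inl, id⟩

/-- The inclusion of the second copy into an expansion. -/
def expansionInr (G₁ G₂ : G.Subgraph) : G₂.coe →g expansion G₁ G₂ := ⟨Sum.inr, id⟩

/-- Vertices of different copies are at distance at most one more than in `G`: a walk in `G` from
`G₁` to `G₂` is followed in the first copy until it meets a common vertex, where the copy is
changed. -/
theorem edist_expansion_inl_inr_le (h₂ : IsIsometricSubgraph G₂) (hsup : G₁ ⊔ G₂ = ⊤)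
    (a : G₁.verts) (b : G₂.verts) :
    (expansion G₁ G₂).edist (Sum.inl a) (Sum.inr b) ≤ G.edist a b + 1 := by
  have key : ∀ {u v : V} (p : G.Walk u v) (hu : u ∈ G₁.verts) (hv : v ∈ G₂.verts),
      (expansion G₁ G₂).edist (Sum.inl ⟨u, hu⟩) (Sum.inr ⟨v, hv⟩) ≤ p.length + 1 := by
    -- At a common vertex one can change copies.
    have hcross : ∀ {u v : V} (p : G.Walk u v) (hu : u ∈ G₁.verts) (hv : v ∈ G₂.verts),
        u ∈ G₂.verts →
        (expansion G₁ G₂).edist (Sum.inl ⟨u, hu⟩) (Sum.inr ⟨v, hv⟩) ≤ p.length + 1 := by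
      intro u v p hu hv hu'
      calc _ ≤ (expansion G₁ G₂).edist (Sum.inl ⟨u, hu⟩) (Sum.inr ⟨u, hu'⟩) +
              (expansion G₁ G₂).edist (Sum.inr ⟨u, hu'⟩) (Sum.inr ⟨v, hv⟩) :=
            SimpleGraph.edist_triangle
        _ ≤ 1 + p.length := by
            refine add_le_add (edist_eq_one_iff_adj.2 rfl).le ?_
            refine (edist_map_le (expansionInr G₁ G₂) ⟨u, hu'⟩ ⟨v, hv⟩).trans ?_
            rw [← h₂ ⟨u, hu'⟩ ⟨v, hv⟩]
            exact edist_le p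
        _ = _ := add_comm _ _
    intro u v p hu hv
    induction p with
    | nil => exact hcross _ hu hv hv
    | @cons u w v h p ih =>
      by_cases hu' : u ∈ G₂.verts
      · exact hcross _ hu hv hu'
      have hadj : G₁.Adj u w := by
        have : (G₁ ⊔ G₂).Adj u w := by rw [hsup]; exact h
        exact (Subgraph.sup_adj.1 this).resolve_right fun h' => hu' h'.fst_mem
      have hw := hadj.snd_mem
      calc _ ≤ (expansion G₁ G₂).edist (Sum.inl ⟨u, hu⟩) (Sum.inl ⟨w, hw⟩) +
              (expansion G₁ G₂).edist (Sum.inl ⟨w, hw⟩) (Sum.inr ⟨v, hv⟩) :=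
            SimpleGraph.edist_triangle
        _ ≤ 1 + (p.length + 1) := add_le_add (edist_eq_one_iff_adj.2 hadj).le (ih hw hv)
        _ = _ := by rw [Walk.length_cons]; push_cast; ring
  by_cases htop : G.edist a b = ⊤
  · simp [htop]
  obtain ⟨p, hp⟩ := exists_walk_of_edist_ne_top htop
  rw [← hp]
  exact key p a.2 b.2

/-- The embedding of an expansion: a new coordinate `none` tells the two copies apart. -/
def expansionMap {X : Type*} (f : V → Finset X) : G₁.verts ⊕ G₂.verts → Finset (Option X) :=
  Sum.elim (fun a => (f a).map Function.Embedding.some) (fun b => insertNone (f b))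

theorem some_mem_expansionMap {X : Type*} (f : V → Finset X) (c : G₁.verts ⊕ G₂.verts) (x : X) :
    some x ∈ expansionMap f c ↔ x ∈ f (Sum.elim Subtype.val Subtype.val c) := by
  cases c <;> simp [expansionMap]

theorem none_mem_expansionMap {X : Type*} (f : V → Finset X) (c : G₁.verts ⊕ G₂.verts) :
    none ∈ expansionMap f c ↔ c.isRight := by
  cases c <;> simp [expansionMap]

theorem symmDiff_expansionMap {X : Type*} [DecidableEq X] (f : V → Finset X)
    (c d : G₁.verts ⊕ G₂.verts) :
    (symmDiff (expansionMap f c) (expansionMap f d)).card =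
      (symmDiff (f (Sum.elim Subtype.val Subtype.val c))
        (f (Sum.elim Subtype.val Subtype.val d))).card + if c.isRight = d.isRight then 0 else 1 := by
  split_ifs with h
  · rw [add_zero, ← card_map (s := symmDiff (f _) _) Function.Embedding.some]
    refine congrArg Finset.card ?_
    ext (_ | x)
    · simp [mem_symmDiff, none_mem_expansionMap, h]
    · simp [mem_symmDiff, some_mem_expansionMap]
  · rw [← card_insertNone]
    refine congrArg Finset.card ?_
    ext (_ | x)
    · simp only [mem_symmDiff, none_mem_expansionMap, none_mem_insertNone, iff_true]
      grind
    · simp [mem_symmDiff, some_mem_expansionMap]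

theorem isIsometricEmbedding_expansionMap {X : Type*} {f : V → Finset X}
    (hf : IsIsometricEmbedding G (hypercube X) f)
    (h₁ : IsIsometricSubgraph G₁) (h₂ : IsIsometricSubgraph G₂) (hsup : G₁ ⊔ G₂ = ⊤) :
    IsIsometricEmbedding (expansion G₁ G₂) (hypercube (Option X)) (expansionMap f) := by
  classical
  have hd := isIsometricEmbedding_hypercube_iff.1 hf
  rw [isIsometricEmbedding_hypercube_iff]
  have hlr : ∀ a b, (expansion G₁ G₂).edist (Sum.inl a) (Sum.inr b) ≤
      ((symmDiff (expansionMap (G₁ := G₁) (G₂ := G₂) f (Sum.inl a))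
        (expansionMap (G₁ := G₁) (G₂ := G₂) f (Sum.inr b))).card : ℕ∞) := by
    intro a b
    rw [symmDiff_expansionMap]
    push_cast
    rw [Sum.elim_inl, Sum.elim_inr, ← hd]
    exact edist_expansion_inl_inr_le h₂ hsup a b
  intro c d
  refine le_antisymm ?_ (card_symmDiff_le_edist ?_ c d)
  · rcases c with a | a <;> rcases d with b | b
    · refine (edist_map_le (expansionInl G₁ G₂) a b).trans_eq ?_
      rw [← h₁ a b, hd, symmDiff_expansionMap]
      simp
    · exact hlr a b
    · rw [SimpleGraph.edist_comm, symmDiff_comm]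
      exact hlr b a
    · refine (edist_map_le (expansionInr G₁ G₂) a b).trans_eq ?_
      rw [← h₂ a b, hd, symmDiff_expansionMap]
      simp
  · rintro (a | a) (b | b) h
    · simpa [symmDiff_expansionMap] using hf.adj_iff.1 (G₁.adj_sub h)
    · have : (a : V) = b := h
      simp [symmDiff_expansionMap, this]
    · have : (a : V) = b := h
      simp [symmDiff_expansionMap, this]
    · simpa [symmDiff_expansionMap] using hf.adj_iff.1 (G₂.adj_sub h)

theorem cutCoords_expansionMap {X : Type*} (f : V → Finset X) (hn₁ : G₁.verts.Nonempty)
    (hn₂ : G₂.verts.Nonempty) (hsup : G₁ ⊔ G₂ = ⊤) :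
    cutCoords (expansionMap (G₁ := G₁) (G₂ := G₂) f) = insert none (some '' cutCoords f) := by
  have hlift : ∀ v : V, ∃ c : G₁.verts ⊕ G₂.verts, Sum.elim Subtype.val Subtype.val c = v := by
    intro v
    have : v ∈ (G₁ ⊔ G₂).verts := by rw [hsup]; trivial
    rcases this with h | h
    exacts [⟨Sum.inl ⟨v, h⟩, rfl⟩, ⟨Sum.inr ⟨v, h⟩, rfl⟩]
  obtain ⟨a, ha⟩ := hn₁
  obtain ⟨b, hb⟩ := hn₂
  ext (_ | x)
  · simp only [Set.mem_insert_iff, true_or, iff_true]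
    exact ⟨Sum.inr ⟨b, hb⟩, Sum.inl ⟨a, ha⟩, by simp [none_mem_expansionMap]⟩
  · simp only [cutCoords, Set.mem_ofPred_eq, some_mem_expansionMap, Set.mem_insert_iff,
      reduceCtorEq, Set.mem_image, Option.some.injEq, exists_eq_right, false_or]
    constructor
    · rintro ⟨c, d, h⟩
      exact ⟨_, _, h⟩
    · rintro ⟨v, w, h⟩
      obtain ⟨c, rfl⟩ := hlift v
      obtain ⟨d, rfl⟩ := hlift w
      exact ⟨c, d, h⟩

end Expansion

theorem IsIsometricEmbedding.comp_iso {V W X : Type*} {G : SimpleGraph V} {G' : SimpleGraph W}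
    {f : V → Finset X} (hf : IsIsometricEmbedding G (hypercube X) f) (φ : G' ≃g G) :
    IsIsometricEmbedding G' (hypercube X) (f ∘ φ) := fun a b =>
  (hf _ _).trans (edist_iso φ a b)

theorem cutCoords_comp {V W X : Type*} (f : V → Finset X) {φ : W → V}
    (hφ : Function.Surjective φ) : cutCoords (f ∘ φ) = cutCoords f := by
  ext x
  exact (hφ.exists₂ (p := fun a b => x ∈ f a ∧ x ∉ f b)).symm

/-- Each expansion adds exactly one separating coordinate. -/
theorem ObtainedByExpansions.exists_embedding {n : ℕ} {V : Type u} {G : SimpleGraph V}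
    (h : ObtainedByExpansions n G) : ∃ (X : Type u) (f : V → Finset X),
      IsIsometricEmbedding G (hypercube X) f ∧ Cardinal.mk (cutCoords f) = n := by
  induction h with
  | @single V G h =>
    obtain ⟨φ⟩ := h
    have : Subsingleton V := φ.symm.toEquiv.subsingleton
    refine ⟨PEmpty, fun _ => ∅, fun a b => ?_, ?_⟩
    · rw [Subsingleton.elim a b]
      simp
    · rw [Nat.cast_zero, Cardinal.mk_eq_zero_iff]
      infer_instance
  | @expand n V W G G' h h' ih =>
    obtain ⟨X, f, hf, hn⟩ := ih
    obtain ⟨-, G₁, G₂, hn₁, hn₂, h₁, h₂, hsup, ⟨φ⟩⟩ := h'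
    refine ⟨Option X, _, (isIsometricEmbedding_expansionMap hf h₁ h₂ hsup).comp_iso φ.symm, ?_⟩
    rw [cutCoords_comp _ φ.symm.surjective, cutCoords_expansionMap f hn₁ hn₂ hsup,
      Cardinal.mk_insert (by simp), Cardinal.mk_image_eq (Option.some_injective _), hn]
    simp

/-! ### Contracting a coordinate -/

section Contraction

variable {V X : Type u} [DecidableEq X] {G : SimpleGraph V} {f : V → Finset X} {x : X}

theorem symmDiff_erase (P Q : Finset X) (x : X) :
    symmDiff (P.erase x) (Q.erase x) = (symmDiff P Q).erase x := by
  ext y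
  simp only [mem_symmDiff, mem_erase]
  tauto

/-- The contraction of `G` along the coordinate `x`: the vertices `f a` are deprived of `x`, and
adjacency is that of the hypercube. -/
def contraction (f : V → Finset X) (x : X) : SimpleGraph (Set.range fun a => (f a).erase x) :=
  (hypercube X).induce _

/-- The vertex of the contraction that comes from `a`. -/
def toContraction (f : V → Finset X) (x : X) (a : V) : Set.range fun a => (f a).erase x :=
  ⟨_, a, rfl⟩

theorem toContraction_surjective : Function.Surjective (toContraction f x) := by
  rintro ⟨_, a, rfl⟩
  exact ⟨a, rfl⟩

theorem contraction_adj_iff {a b : V} :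
    (contraction f x).Adj (toContraction f x a) (toContraction f x b) ↔
      ((symmDiff (f a) (f b)).erase x).card = 1 := by
  rw [← symmDiff_erase, ← hypercube_adj_iff]
  rfl

theorem toContraction_eq_iff {a b : V} :
    toContraction f x a = toContraction f x b ↔ (symmDiff (f a) (f b)).erase x = ∅ := by
  rw [← symmDiff_erase, ← Finset.bot_eq_empty, symmDiff_eq_bot]
  exact Subtype.ext_iff

/-- Among the vertices with the same image as `a`, there is one from which a step removes a
difference to `b` other than `x`. -/
theorem exists_step_contraction (hf : IsIsometricEmbedding G (hypercube X) f) {a b : V}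
    (h : toContraction f x a ≠ toContraction f x b) :
    ∃ a' v, toContraction f x a' = toContraction f x a ∧ G.Adj a' v ∧
      ∃ y ∈ (symmDiff (f a) (f b)).erase x, symmDiff (f a') (f v) = {y} := by
  have hne : ∀ {c}, toContraction f x c ≠ toContraction f x b → f c ≠ f b := by
    intro c h hc
    exact h (by rw [toContraction_eq_iff, hc]; simp)
  obtain ⟨v, hav, y, hy, hyv⟩ := hf.exists_step (hne h)
  by_cases hyx : y = x
  · subst hyx
    have hva : toContraction f y v = toContraction f y a := by
      rw [eq_comm, toContraction_eq_iff, hyv]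
      simp
    obtain ⟨w, hvw, z, hz, hzw⟩ := hf.exists_step (hne (hva ▸ h))
    have hyb : y ∉ symmDiff (f v) (f b) := by
      have : y ∈ symmDiff (f a) (f v) := by simp [hyv]
      simp only [mem_symmDiff] at this hy ⊢
      tauto
    refine ⟨v, w, hva, hvw, z, ?_, hzw⟩
    have hva' : (f v).erase y = (f a).erase y := congrArg Subtype.val hva
    rw [← symmDiff_erase, ← hva', symmDiff_erase]
    exact mem_erase.2 ⟨fun h => hyb (h ▸ hz), hz⟩
  · exact ⟨a, v, rfl, hav, y, mem_erase.2 ⟨hyx, hy⟩, hyv⟩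

theorem isIsometricEmbedding_contraction (hf : IsIsometricEmbedding G (hypercube X) f) :
    IsIsometricEmbedding (contraction f x) (hypercube X) Subtype.val := by
  rw [isIsometricEmbedding_hypercube_iff]
  refine edist_eq_of_step Subtype.val_injective (fun _ _ h => hypercube_adj_iff.1 h) ?_
  intro p q h
  obtain ⟨a, rfl⟩ := toContraction_surjective p
  obtain ⟨b, rfl⟩ := toContraction_surjective q
  obtain ⟨a', v, ha', -, y, hy, hyv⟩ := exists_step_contraction hf (fun h' => h (by rw [h']))
  have hyx := (mem_erase.1 hy).1
  rw [← ha']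
  refine ⟨toContraction f x v, ?_, y, ?_, ?_⟩
  · rw [contraction_adj_iff, hyv, erase_eq_of_notMem (by simpa using hyx.symm), card_singleton]
  · rw [ha']
    exact (symmDiff_erase (f a) (f b) x).symm ▸ hy
  · refine (symmDiff_erase (f a') (f v) x).trans ?_
    rw [hyv, erase_eq_of_notMem (by simpa using hyx.symm)]

theorem cutCoords_contraction :
    cutCoords (Subtype.val : (Set.range fun a => (f a).erase x) → Finset X) =
      cutCoords f \ {x} := by
  rw [← cutCoords_comp _ (toContraction_surjective (f := f) (x := x))]
  ext y
  simp only [cutCoords, toContraction, Function.comp_apply, mem_erase, Set.mem_sdiff,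
    Set.mem_ofPred_eq, Set.mem_singleton_iff]
  constructor
  · rintro ⟨a, b, h, h'⟩
    exact ⟨⟨a, b, h.2, fun hb => h' ⟨h.1, hb⟩⟩, h.1⟩
  · rintro ⟨⟨a, b, h, h'⟩, hy⟩
    exact ⟨a, b, ⟨hy, h⟩, fun hb => h' hb.2⟩

/-- The image in the contraction of one of the two sides of the cut given by `x`, the one whose
vertices `a` satisfy `x ∈ f a ↔ ε`. -/
def side (f : V → Finset X) (x : X) (ε : Prop) : (contraction f x).Subgraph :=
  (⊤ : (contraction f x).Subgraph).induce (toContraction f x '' {a | x ∈ f a ↔ ε})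

theorem mem_side (a : V) : toContraction f x a ∈ (side f x (x ∈ f a)).verts := ⟨a, Iff.rfl, rfl⟩

/-- Geodesics between two vertices on the same side of the cut never cross it. -/
theorem isIsometricSubgraph_side (hf : IsIsometricEmbedding G (hypercube X) f) (ε : Prop) :
    IsIsometricSubgraph (side f x ε) := by
  -- It suffices that `side f x ε`, like the contraction, carries the Hamming distance.
  suffices h : IsIsometricEmbedding (side f x ε).coe (hypercube X) (fun p => p.1.1) from
    fun p q => by rw [← h p q, isIsometricEmbedding_contraction hf]
  rw [isIsometricEmbedding_hypercube_iff]
  refine edist_eq_of_step (fun _ _ h => Subtype.ext (Subtype.ext h))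
    (fun _ _ h => hypercube_adj_iff.1 ((side f x ε).adj_sub h)) ?_
  rintro ⟨_, a, ha, rfl⟩ ⟨_, b, hb, rfl⟩ h
  obtain ⟨v, hav, y, hy, hyv⟩ := hf.exists_step (a := a) (b := b)
    fun h' => h (by simp [toContraction, h'])
  have hyx : y ≠ x := by
    rintro rfl
    simp only [Set.mem_ofPred_eq, mem_symmDiff] at ha hb hy
    grind
  have hxv : x ∈ f v ↔ ε := by
    have : x ∉ symmDiff (f a) (f v) := by simpa [hyv] using hyx.symm
    simp only [Set.mem_ofPred_eq, mem_symmDiff] at ha this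
    grind
  refine ⟨⟨toContraction f x v, v, hxv, rfl⟩, ⟨⟨a, ha, rfl⟩, ⟨v, hxv, rfl⟩, ?_⟩, y, ?_, ?_⟩
  · rw [Subgraph.top_adj, contraction_adj_iff, hyv, erase_eq_of_notMem (by simpa using hyx.symm),
      card_singleton]
  · exact (symmDiff_erase (f a) (f b) x).symm ▸ mem_erase.2 ⟨hyx, hy⟩
  · refine (symmDiff_erase (f a) (f v) x).trans ?_
    rw [hyv, erase_eq_of_notMem (by simpa using hyx.symm)]

/-- Every edge of the contraction lies in one of the two sides. -/
theorem side_sup_side (hf : IsIsometricEmbedding G (hypercube X) f) :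
    side f x False ⊔ side f x True = ⊤ := by
  have hside : ∀ ε, side f x ε ≤ side f x False ⊔ side f x True := by
    intro ε
    by_cases h : ε
    · simp only [h, le_sup_right]
    · simp only [h, le_sup_left]
  refine top_le_iff.1 ⟨fun p _ => ?_, fun p q h => ?_⟩
  · obtain ⟨a, rfl⟩ := toContraction_surjective p
    exact (hside _).1 (mem_side a)
  · obtain ⟨a, rfl⟩ := toContraction_surjective p
    obtain ⟨b, rfl⟩ := toContraction_surjective q
    -- An edge of the contraction comes from an edge of `G` that does not cross the cut.
    have hadj : (contraction f x).Adj (toContraction f x a) (toContraction f x b) := h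
    obtain ⟨a', v, ha', -, y, hy, hyv⟩ := exists_step_contraction hf hadj.ne
    have hyx := (mem_erase.1 hy).1
    obtain ⟨z, hz⟩ := card_eq_one.1 (contraction_adj_iff.1 hadj)
    obtain rfl : y = z := by simpa [hz] using hy
    have hv : toContraction f x v = toContraction f x b := by
      apply Subtype.ext
      have h1 : symmDiff ((f a').erase x) ((f v).erase x) = {y} := by
        rw [symmDiff_erase, hyv, erase_eq_of_notMem (by simpa using hyx.symm)]
      have h2 : symmDiff ((f a').erase x) ((f b).erase x) = {y} := by
        rw [show (f a').erase x = (f a).erase x from congrArg Subtype.val ha', symmDiff_erase, hz]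
      exact symmDiff_right_injective _ (h1.trans h2.symm)
    have hxv : x ∈ f v ↔ x ∈ f a' := by
      have : x ∉ symmDiff (f a') (f v) := by simpa [hyv] using hyx.symm
      simp only [mem_symmDiff] at this
      tauto
    refine (hside (x ∈ f a')).2 ⟨⟨a', Iff.rfl, ha'⟩, ⟨v, hxv, hv⟩, hadj⟩

theorem contraction_connected [Nonempty V] (hf : IsIsometricEmbedding G (hypercube X) f) :
    (contraction f x).Connected :=
  have : Nonempty (Set.range fun a => (f a).erase x) := ‹Nonempty V›.map (toContraction f x)
  ⟨(isIsometricEmbedding_contraction hf).preconnected⟩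

/-- Sends a vertex to its image in the contraction, in the copy given by its side of the cut. -/
def toExpansion (f : V → Finset X) (x : X) (a : V) :
    (side f x False).verts ⊕ (side f x True).verts :=
  if h : x ∈ f a then Sum.inr ⟨toContraction f x a, a, by simpa, rfl⟩
  else Sum.inl ⟨toContraction f x a, a, by simpa, rfl⟩

theorem toExpansion_bijective (hf : IsIsometricEmbedding G (hypercube X) f) :
    Function.Bijective (toExpansion f x) := by
  constructor
  · intro a b h
    refine hf.injective ?_
    have key : ∀ {a b}, toContraction f x a = toContraction f x b → (x ∈ f a ↔ x ∈ f b) →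
        f a = f b := by
      intro a b h h'
      have h : (f a).erase x = (f b).erase x := congrArg Subtype.val h
      ext y
      by_cases hy : y = x
      · rw [hy, h']
      · simpa [hy] using Finset.ext_iff.1 h y
    by_cases ha : x ∈ f a <;> by_cases hb : x ∈ f b <;> simp [toExpansion, ha, hb] at h
    · exact key (congrArg Subtype.val h) (by simp [ha, hb])
    · exact key (congrArg Subtype.val h) (by simp [ha, hb])
  · rintro (⟨_, a, ha, rfl⟩ | ⟨_, a, ha, rfl⟩)
    · have : x ∉ f a := by simpa using ha
      exact ⟨a, by simp [toExpansion, this]⟩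
    · have : x ∈ f a := by simpa using ha
      exact ⟨a, by simp [toExpansion, this]⟩

theorem side_adj_iff {ε : Prop} {a b : V} (ha : x ∈ f a ↔ ε) (hb : x ∈ f b ↔ ε) :
    (side f x ε).Adj (toContraction f x a) (toContraction f x b) ↔
      (symmDiff (f a) (f b)).card = 1 := by
  have hx : x ∉ symmDiff (f a) (f b) := by
    simp only [mem_symmDiff]
    tauto
  rw [← erase_eq_of_notMem hx, ← contraction_adj_iff]
  exact ⟨fun h => (side f x ε).adj_sub h, fun h => ⟨⟨a, ha, rfl⟩, ⟨b, hb, rfl⟩, h⟩⟩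

theorem toContraction_eq_iff_card {a b : V} (h : x ∈ symmDiff (f a) (f b)) :
    toContraction f x a = toContraction f x b ↔ (symmDiff (f a) (f b)).card = 1 := by
  rw [toContraction_eq_iff, ← card_eq_zero, ← card_erase_add_one h]
  omega

theorem expansion_adj_toExpansion (hf : IsIsometricEmbedding G (hypercube X) f) {a b : V} :
    (expansion (side f x False) (side f x True)).Adj (toExpansion f x a) (toExpansion f x b) ↔
      G.Adj a b := by
  rw [hf.adj_iff]
  by_cases ha : x ∈ f a <;> by_cases hb : x ∈ f b <;> simp only [toExpansion, ha, hb, dite_true,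
    dite_false]
  · exact side_adj_iff (by simpa) (by simpa)
  · exact toContraction_eq_iff_card (by simp [mem_symmDiff, ha, hb])
  · exact toContraction_eq_iff_card (by simp [mem_symmDiff, ha, hb])
  · exact side_adj_iff (by simpa) (by simpa)

/-- A partial cube is an expansion of its contraction along a coordinate that separates two of its
vertices. -/
theorem isExpansion_contraction (hf : IsIsometricEmbedding G (hypercube X) f)
    (hx : x ∈ cutCoords f) : IsExpansion (contraction f x) G := by
  obtain ⟨a, b, ha, hb⟩ := hx
  have : Nonempty V := ⟨a⟩
  refine ⟨contraction_connected hf, side f x False, side f x True, ⟨_, b, by simpa, rfl⟩,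
    ⟨_, a, by simpa, rfl⟩, isIsometricSubgraph_side hf _, isIsometricSubgraph_side hf _,
    side_sup_side hf, ⟨?_⟩⟩
  exact RelIso.symm ⟨Equiv.ofBijective _ (toExpansion_bijective (x := x) hf),
    expansion_adj_toExpansion hf⟩

end Contraction

/-- Contracting the separating coordinates one by one exhibits the graph as the result of as many
expansions. -/
theorem IsIsometricEmbedding.obtainedByExpansions {n : ℕ} {V X : Type u} [Nonempty V]
    {G : SimpleGraph V} {f : V → Finset X} (hf : IsIsometricEmbedding G (hypercube X) f)
    (hn : Cardinal.mk (cutCoords f) = n) : ObtainedByExpansions n G := by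
  classical
  induction n generalizing V with
  | zero =>
    have : IsEmpty (cutCoords f) := Cardinal.mk_eq_zero_iff.1 (by simpa using hn)
    have hsub : Subsingleton V := ⟨fun a b => hf.injective (by
      ext x
      by_contra h
      refine this.false (α := cutCoords f) ⟨x, ?_⟩
      by_cases ha : x ∈ f a
      · exact ⟨a, b, ha, fun hb => h (by simp [ha, hb])⟩
      · exact ⟨b, a, by_contra fun hb => h (by simp [ha, hb]), ha⟩)⟩
    have : Unique V := @Unique.mk' V (Classical.inhabited_of_nonempty ‹_›) hsub
    exact .single ⟨⟨Equiv.ofUnique (Fin 1) V, fun {a b} => by simp [Subsingleton.elim a b]⟩⟩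
  | succ n ih =>
    obtain ⟨x, hx⟩ : (cutCoords f).Nonempty := by
      rw [Set.nonempty_iff_ne_empty]
      intro h
      rw [h, Cardinal.mk_eq_zero] at hn
      exact Nat.cast_ne_zero.2 n.succ_ne_zero hn.symm
    have : Nonempty (Set.range fun a => (f a).erase x) := ‹Nonempty V›.map (toContraction f x)
    refine .expand (ih (isIsometricEmbedding_contraction (x := x) hf) ?_)
      (isExpansion_contraction hf hx)
    rw [cutCoords_contraction]
    have h : Cardinal.mk (cutCoords f \ {x} : Set X) + 1 = n + 1 := by
      rw [← Cardinal.mk_insert (Set.notMem_sdiff_of_mem (Set.mem_singleton x)),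
        Set.insert_sdiff_singleton, Set.insert_eq_of_mem hx, hn]
      simp
    exact Cardinal.add_one_inj.1 h

end PartialCube

theorem corollary8p2 {V : Type u} [Finite V] (G : SimpleGraph V) (hG : G.Connected) :
    (PartialCube.IsPartialCube G ↔ ∃ n : ℕ, PartialCube.ObtainedByExpansions n G) ∧
    (PartialCube.IsPartialCube G →
      ∀ n : ℕ, PartialCube.ObtainedByExpansions n G ↔
        (n : Cardinal.{u}) = PartialCube.isometricDim G) := by
  have := hG.nonempty
  refine ⟨⟨?_, ?_⟩, ?_⟩
  · rintro ⟨X, f, hf⟩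
    -- As `V` is finite, finitely many elements of `X` occur in the image of `f`.
    have hfin : (PartialCube.cutCoords f).Finite :=
      (Set.finite_iUnion fun a => (f a).finite_toSet).subset fun x ⟨a, _, hx, _⟩ =>
        Set.mem_iUnion.2 ⟨a, hx⟩
    exact ⟨_, hf.obtainedByExpansions (Set.cast_ncard hfin).symm⟩
  · rintro ⟨n, hn⟩
    obtain ⟨X, f, hf, -⟩ := hn.exists_embedding
    exact ⟨X, f, hf⟩
  · rintro ⟨X, f, hf⟩ n
    constructor
    · intro hn
      obtain ⟨Y, g, hg, hc⟩ := hn.exists_embedding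
      rw [PartialCube.isometricDim_eq hg, hc]
    · intro hn
      exact hf.obtainedByExpansions (by rw [hn, PartialCube.isometricDim_eq hf])
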